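/- Let $\mathscr O=\mathbb C\{t\}$ be the ring of germs at $t=0$ of holomorphic functions of one complex variable and $\epsilon=t\frac{d}{dt}$. A *Fuchsian operator* of order $n\ge 0$ is a differential operator $L=\sum_{k=0}^n a_k(t)\epsilon^k$ with $a_k\in\mathscr O$ and $a_n(0)\ne0$; its *Euler part* is the polynomial $p_0(\epsilon)=\sum_{k=0}^n a_k(0)\epsilon^k\in\mathbb C[\epsilon]$. Operators are multiplied by composition. Two Fuchsian operators $L,M$ of the same order are *$\mathscr F$-equivalent* if there are Fuchsian operators $H,K$ (of any orders) such that $MH=KL$ and the Euler parts of $H$ and $L$ are coprime in $\mathbb C[\epsilon]$. Let $L$ be a Fuchsian operator of order $n$ with Euler part $p_0$. For $\mu\in\mathbb C$ put $J(\mu)=\{j\in\mathbb Z:\ j\ge1,\ p_0(\mu+j)=0\}$. The roots of $p_0$, repeated according to their multiplicities, can be enumerated as $\lambda_1,\dots,\lambda_n$ in such a way that $i<k$ whenever $\lambda_k-\lambda_i$ is a positive integer. For every such enumeration, $L$ is $\mathscr F$-equivalent to a completely reducible operator $$M=(\epsilon-\lambda_1+r_1(t))(\epsilon-\lambda_2+r_2(t))\cdots(\epsilon-\lambda_n+r_n(t)),\qquad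 r_1,\dots,r_n\in\mathbb C[t],$$ where for every $i$ the exponents of all monomials that occur in $r_i$ with a nonzero coefficient belong to $J(\lambda_i)$. In particular, $r_i=0$ if $J(\lambda_i)=\varnothing$, and $\deg r_i\le\max J(\lambda_i)$ otherwise. -/

import Mathlib

open Polynomial

noncomputable section

/-- The power series `f` is the Taylor series at `0` of a function holomorphic near `0`. The series
with this property form the ring `𝒪(ℂ, 0) = ℂ{t}` of germs of holomorphic functions. -/
def IsHolomorphicGerm (f : PowerSeries ℂ) : Prop :=
  ∃ g : ℂ → ℂ, HasFPowerSeriesAt g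
    (FormalMultilinearSeries.ofScalars ℂ fun k => PowerSeries.coeff k f) 0

/-- The operator `u ↦ a u` of multiplication by `a`. -/
def mulOp (a : PowerSeries ℂ) : Module.End ℂ (PowerSeries ℂ) :=
  LinearMap.mulLeft ℂ a

/-- The Euler derivation `ε = t · d/dt`. -/
def eulerOp : Module.End ℂ (PowerSeries ℂ) :=
  mulOp PowerSeries.X * (PowerSeries.derivative ℂ).toLinearMap

/-- The differential operator `∑ aₖ(t) εᵏ` (coefficients to the left of the powers of `ε`). The
product of operators is composition, that is, multiplication in `Module.End`. -/
def diffOp (a : (PowerSeries ℂ)[X]) : Module.End ℂ (PowerSeries ℂ) :=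
  a.sum fun k c => mulOp c * eulerOp ^ k

/-- The commutation rule `ε a = a ε + ε(a)`. -/
theorem eulerOp_mul_mulOp (a : PowerSeries ℂ) :
    eulerOp * mulOp a = mulOp a * eulerOp + mulOp (eulerOp a) := by
  ext1 u
  simp [eulerOp, mulOp, Derivation.leibniz]
  ring

theorem eulerOp_pow_X_pow (k m : ℕ) :
    (eulerOp ^ k) (PowerSeries.X ^ m : PowerSeries ℂ)
      = (m : PowerSeries ℂ) ^ k * PowerSeries.X ^ m := by
  have h1 : eulerOp (PowerSeries.X ^ m : PowerSeries ℂ)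
      = (m : ℂ) • (PowerSeries.X ^ m : PowerSeries ℂ) := by
    rcases m with _ | m
    · simp [eulerOp, mulOp]
    · simp [eulerOp, mulOp, Derivation.leibniz_pow, PowerSeries.smul_eq_C_mul]
      ring
  have h2 : (eulerOp ^ k) (PowerSeries.X ^ m : PowerSeries ℂ)
      = ((m : ℂ) ^ k) • (PowerSeries.X ^ m : PowerSeries ℂ) := by
    induction k with
    | zero => simp
    | succ k ih =>
      rw [pow_succ', Module.End.mul_apply, ih, map_smul, h1, smul_smul, pow_succ]
  rw [h2, PowerSeries.smul_eq_C_mul]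
  simp

/-- The representation of an operator as `∑ aₖ(t) εᵏ` is unique. -/
theorem diffOp_injective : Function.Injective diffOp := by
  have key : ∀ (a : (PowerSeries ℂ)[X]) (m : ℕ), diffOp a (PowerSeries.X ^ m)
      = a.eval (m : PowerSeries ℂ) * PowerSeries.X ^ m := by
    intro a m
    rw [Polynomial.eval_eq_sum, Polynomial.sum, diffOp, Polynomial.sum, LinearMap.sum_apply,
      Finset.sum_mul]
    refine Finset.sum_congr rfl fun k _ => ?_
    rw [Module.End.mul_apply, eulerOp_pow_X_pow]
    simp [mulOp, mul_assoc]
  intro a b hab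
  have : CharZero (PowerSeries ℂ) :=
    charZero_of_injective_ringHom (f := PowerSeries.C (R := ℂ)) PowerSeries.C_injective
  refine Polynomial.eq_of_infinite_eval_eq a b ?_
  refine (Set.infinite_range_of_injective
    (Nat.cast_injective (R := PowerSeries ℂ))).mono ?_
  rintro _ ⟨m, rfl⟩
  have h := congrArg (fun T => T (PowerSeries.X ^ m : PowerSeries ℂ)) hab
  simp only [key] at h
  exact mul_right_cancel₀ (pow_ne_zero m PowerSeries.X_ne_zero) h

/-- A Fuchsian operator `∑_{k ≤ n} aₖ(t) εᵏ`: the coefficients are holomorphic germs and the leading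
one does not vanish at `0`. Order zero (an invertible holomorphic germ) is allowed. -/
structure FuchsianOperator where
  coeffs : (PowerSeries ℂ)[X]
  holomorphic : ∀ k, IsHolomorphicGerm (coeffs.coeff k)
  leading_ne_zero : PowerSeries.constantCoeff coeffs.leadingCoeff ≠ 0

namespace FuchsianOperator

/-- The operator itself. -/
def op (L : FuchsianOperator) : Module.End ℂ (PowerSeries ℂ) := diffOp L.coeffs

/-- The order `n` of the operator. -/
def order (L : FuchsianOperator) : ℕ := L.coeffs.natDegree

/-- The Euler part `∑ aₖ(0) εᵏ`, a polynomial in `ε`; it is the coefficient `p₀` of the expansion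
`∑ tʲ pⱼ(ε)` of the operator. -/
def eulerPart (L : FuchsianOperator) : ℂ[X] :=
  L.coeffs.map (PowerSeries.constantCoeff (R := ℂ))

/-- Fuchsian equivalence: `M H = K L` for some Fuchsian operators `H`, `K` of any orders such that
the Euler parts of `H` and `L` are coprime. -/
def FEquiv (L M : FuchsianOperator) : Prop :=
  L.order = M.order ∧ ∃ H K : FuchsianOperator,
    M.op * H.op = K.op * L.op ∧ IsCoprime H.eulerPart L.eulerPart

end FuchsianOperator

/-- The family `lam` lists all roots of `p` with their multiplicities, and inside each class of roots
with integer differences the list is non-decreasing; roots in different classes may stand in any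
order. -/
def IsNaturalEnumeration {n : ℕ} (p : ℂ[X]) (lam : Fin n → ℂ) : Prop :=
  p.roots = Finset.univ.val.map lam ∧
    ∀ (i k : Fin n) (j : ℕ), 0 < j → lam k = lam i + j → i < k

/-- The set `J(μ)` of the positive integers `j` such that `μ + j` is a root of `p`. -/
def resonanceOrders (p : ℂ[X]) (μ : ℂ) : Set ℕ :=
  {j | 0 < j ∧ p.IsRoot (μ + j)}

/-- The product `(ε - λ₁ + r₁(t)) ⋯ (ε - λₙ + rₙ(t))`, in this order. -/
def reducibleOp {n : ℕ} (lam : Fin n → ℂ) (r : Fin n → ℂ[X]) :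
    Module.End ℂ (PowerSeries ℂ) :=
  (List.ofFn fun i =>
    eulerOp - mulOp (PowerSeries.C (lam i)) + mulOp (r i : PowerSeries ℂ)).prod

end

noncomputable section

/-! ### Operators as power series in `t` with polynomial coefficients in `ε` -/

/-! Write an operator as `∑ tʲ pⱼ(ε)`. Since `q(ε) tʲ = tʲ q(ε + j)`, the relation `M H = K L`
becomes a recursion on polynomials. Put `P = ∏ (X - λᵢ)` and `p₀ = α P`, and start from `h₀ = α`,
`k₀ = 1`. At order `j` the new unknowns are `hⱼ`, `kⱼ` and the coefficients `δᵢ` of `tʲ` in the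
`rᵢ`. They satisfy `α V(δ) + P(X + j) hⱼ - α P kⱼ = F` with `F` already known and `V` linear
(`firstVariation`).

For fixed `δ` this is solvable exactly when `gcd(P, P(X + j))` divides `F - α V(δ)`. The roots of
this gcd are the resonant `λᵢ`, those for which `λᵢ + j` is also a root;
`exists_dvd_sub_firstVariation` shows that the corresponding `δᵢ` alone achieve divisibility, thanks
to the ordering of the roots. The degrees of `hⱼ`, `kⱼ` stay below `n`, so
`exists_formal_equivalence` can run the recursion.

There are finitely many resonances, so `M` is polynomial in `t`. Multiplication by `P(X + j)` modulo
`P` expands norms by a factor of order `jⁿ`, which compensates for the argument shifts in the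
products; hence `H` and `K` converge (`geometricGrowth_of_skewMul_eq`).

The resulting `H`, `K` need not be Fuchsian. They are replaced by `H + L` and `K + M`, which satisfy
the same relation; the Euler part `α + p₀` of `H + L` is coprime to `p₀`. -/

/-- The operator `∑ tʲ hⱼ(ε)` given by a sequence of polynomials `hⱼ`. -/
def symbolOp (h : ℕ → ℂ[X]) : Module.End ℂ (PowerSeries ℂ) where
  toFun u := PowerSeries.mk fun N =>
    ∑ p ∈ Finset.HasAntidiagonal.antidiagonal N, (h p.1).eval (p.2 : ℂ) * PowerSeries.coeff p.2 u
  map_add' u v := by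
    ext N
    simp [mul_add, Finset.sum_add_distrib]
  map_smul' c u := by
    ext N
    simp only [PowerSeries.coeff_mk, PowerSeries.coeff_smul, smul_eq_mul, RingHom.id_apply,
      Finset.mul_sum]
    exact Finset.sum_congr rfl fun p _ => by ring

theorem coeff_symbolOp (h : ℕ → ℂ[X]) (u : PowerSeries ℂ) (N : ℕ) :
    PowerSeries.coeff N (symbolOp h u) =
      ∑ p ∈ Finset.HasAntidiagonal.antidiagonal N, (h p.1).eval (p.2 : ℂ) * PowerSeries.coeff p.2 u := by
  simp [symbolOp]

/-- The coefficients of a product of operators `∑ tʲ mⱼ(ε)` and `∑ tʲ hⱼ(ε)`. -/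
def skewMul (m h : ℕ → ℂ[X]) (j : ℕ) : ℂ[X] :=
  ∑ p ∈ Finset.HasAntidiagonal.antidiagonal j, taylor (p.2 : ℂ) (m p.1) * h p.2

theorem symbolOp_skewMul (m h : ℕ → ℂ[X]) :
    symbolOp (skewMul m h) = symbolOp m * symbolOp h := by
  ext u N
  rw [Module.End.mul_apply, coeff_symbolOp, coeff_symbolOp]
  simp only [coeff_symbolOp, skewMul, eval_finsetSum, Finset.mul_sum, Finset.sum_mul, eval_mul,
    taylor_eval]
  rw [Finset.sum_sigma', Finset.sum_sigma']
  -- Both sides sum `m_c(d + b) h_d(b) u_b` over `c + d + b = N`; only the bracketing of the triple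
  -- differs.
  refine Finset.sum_nbij' (fun x => ⟨(x.2.1, x.2.2 + x.1.2), (x.2.2, x.1.2)⟩)
    (fun x => ⟨(x.1.1 + x.2.1, x.2.2), (x.1.1, x.2.1)⟩) ?_ ?_ ?_ ?_ ?_
  · rintro ⟨⟨a, b⟩, c, d⟩; simp; omega
  · rintro ⟨⟨a, b⟩, c, d⟩; simp; omega
  · rintro ⟨⟨a, b⟩, c, d⟩; simp
  · rintro ⟨⟨a, b⟩, c, d⟩; simp
  · rintro ⟨⟨a, b⟩, c, d⟩ _
    push_cast
    rw [add_comm (b : ℂ)]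
    ring

theorem symbolOp_add (m h : ℕ → ℂ[X]) :
    symbolOp (m + h) = symbolOp m + symbolOp h := by
  ext u N
  simp [coeff_symbolOp, add_mul, Finset.sum_add_distrib]

theorem coeff_eulerOp_pow (k : ℕ) (u : PowerSeries ℂ) (N : ℕ) :
    PowerSeries.coeff N ((eulerOp ^ k) u) = (N : ℂ) ^ k * PowerSeries.coeff N u := by
  induction k with
  | zero => simp
  | succ k ih =>
    rw [pow_succ', Module.End.mul_apply]
    rcases N with _ | N
    · simp [eulerOp, mulOp]
    · rw [eulerOp, mulOp, Module.End.mul_apply, LinearMap.mulLeft_apply,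
        PowerSeries.coeff_succ_X_mul, ← mulOp, ← eulerOp, Derivation.coeFn_coe,
        PowerSeries.coeff_derivative, ih]
      push_cast
      ring

/-- The coefficients `pⱼ(ε)` of the expansion `∑ tʲ pⱼ(ε)` of `∑ aₖ(t) εᵏ`. -/
def symbol (a : (PowerSeries ℂ)[X]) (j : ℕ) : ℂ[X] :=
  ∑ k ∈ Finset.range (a.natDegree + 1), monomial k (PowerSeries.coeff j (a.coeff k))

theorem coeff_symbol (a : (PowerSeries ℂ)[X]) (j k : ℕ) :
    (symbol a j).coeff k = PowerSeries.coeff j (a.coeff k) := by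
  simp only [symbol, finsetSum_coeff, coeff_monomial, Finset.sum_ite_eq', Finset.mem_range]
  split_ifs with h
  · rfl
  · rw [coeff_eq_zero_of_natDegree_lt (by omega), map_zero]

theorem diffOp_eq_symbolOp (a : (PowerSeries ℂ)[X]) : diffOp a = symbolOp (symbol a) := by
  ext u N
  rw [coeff_symbolOp, diffOp, sum_over_range _ (by intro n; ext; simp [mulOp]),
    LinearMap.sum_apply, map_sum]
  simp only [symbol, eval_finsetSum, eval_monomial, Finset.sum_mul]
  rw [Finset.sum_comm]
  refine Finset.sum_congr rfl fun k _ => ?_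
  rw [Module.End.mul_apply, mulOp, LinearMap.mulLeft_apply, PowerSeries.coeff_mul]
  exact Finset.sum_congr rfl fun p _ => by rw [coeff_eulerOp_pow]; ring

/-! ### Convergence -/

/-- Positive radius of convergence is geometric growth of the coefficients; in the converse
direction the radius is at least `1/ρ`. -/
theorem isHolomorphicGerm_iff (f : PowerSeries ℂ) :
    IsHolomorphicGerm f ↔ ∃ C ρ : ℝ, 0 ≤ C ∧ 0 < ρ ∧ ∀ k, ‖PowerSeries.coeff k f‖ ≤ C * ρ ^ k := by
  constructor
  · rintro ⟨g, r, hg⟩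
    have hpos := hg.r_pos.trans_le hg.r_le
    obtain ⟨C, ρ, hC, hρ, h⟩ := FormalMultilinearSeries.le_mul_pow_of_radius_pos _ hpos
    refine ⟨C, ρ, hC.le, hρ, fun k => ?_⟩
    simpa [FormalMultilinearSeries.ofScalars_norm] using h k
  · rintro ⟨C, ρ, hC, hρ, h⟩
    set p := FormalMultilinearSeries.ofScalars ℂ (fun k => PowerSeries.coeff k f) with hp
    have hr : (ρ⁻¹.toNNReal : ENNReal) ≤ p.radius := by
      refine p.le_radius_of_bound C fun n => ?_
      rw [Real.coe_toNNReal _ (by positivity), hp, FormalMultilinearSeries.ofScalars_norm]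
      calc _ ≤ C * ρ ^ n * ρ⁻¹ ^ n := by gcongr; exact h n
        _ = C := by rw [mul_assoc, ← mul_pow, mul_inv_cancel₀ hρ.ne', one_pow, mul_one]
    have hpos : 0 < p.radius := lt_of_lt_of_le (by simpa using hρ) hr
    exact ⟨p.sum, (p.hasFPowerSeriesOnBall hpos).hasFPowerSeriesAt⟩

/-- The sum of the absolute values of the coefficients. -/
def coeffNorm (p : ℂ[X]) : ℝ := ∑ k ∈ p.support, ‖p.coeff k‖

theorem coeffNorm_eq_of_support_subset {p : ℂ[X]} {s : Finset ℕ} (h : p.support ⊆ s) :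
    coeffNorm p = ∑ k ∈ s, ‖p.coeff k‖ := by
  refine Finset.sum_subset h fun k _ hk => ?_
  rw [notMem_support_iff.1 hk, norm_zero]

theorem coeffNorm_nonneg (p : ℂ[X]) : 0 ≤ coeffNorm p :=
  Finset.sum_nonneg fun _ _ => norm_nonneg _

theorem norm_coeff_le_coeffNorm (p : ℂ[X]) (k : ℕ) : ‖p.coeff k‖ ≤ coeffNorm p := by
  by_cases hk : k ∈ p.support
  · exact Finset.single_le_sum (f := fun k => ‖p.coeff k‖) (fun _ _ => norm_nonneg _) hk
  · rw [notMem_support_iff.1 hk, norm_zero]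
    exact coeffNorm_nonneg p

@[simp] theorem coeffNorm_zero : coeffNorm 0 = 0 := by simp [coeffNorm]

theorem coeffNorm_add_le (p q : ℂ[X]) : coeffNorm (p + q) ≤ coeffNorm p + coeffNorm q := by
  rw [coeffNorm_eq_of_support_subset (Polynomial.support_add (p := p) (q := q)),
    coeffNorm_eq_of_support_subset (Finset.subset_union_left (s₁ := p.support) (s₂ := q.support)),
    coeffNorm_eq_of_support_subset (Finset.subset_union_right (s₁ := p.support) (s₂ := q.support)),
    ← Finset.sum_add_distrib]
  exact Finset.sum_le_sum fun k _ => by rw [coeff_add]; exact norm_add_le _ _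

theorem coeffNorm_sum_le {ι : Type*} (s : Finset ι) (f : ι → ℂ[X]) :
    coeffNorm (∑ i ∈ s, f i) ≤ ∑ i ∈ s, coeffNorm (f i) := by
  classical
  induction s using Finset.induction_on with
  | empty => simp
  | insert i s hi ih =>
    rw [Finset.sum_insert hi, Finset.sum_insert hi]
    exact (coeffNorm_add_le _ _).trans (by gcongr)

theorem coeffNorm_neg (p : ℂ[X]) : coeffNorm (-p) = coeffNorm p := by simp [coeffNorm]

theorem coeffNorm_sub_le (p q : ℂ[X]) : coeffNorm (p - q) ≤ coeffNorm p + coeffNorm q := by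
  rw [sub_eq_add_neg, ← coeffNorm_neg q]
  exact coeffNorm_add_le _ _

theorem coeffNorm_C_mul (c : ℂ) (p : ℂ[X]) : coeffNorm (C c * p) = ‖c‖ * coeffNorm p := by
  have h : (C c * p).support ⊆ p.support := by
    intro k; simp only [mem_support_iff, coeff_C_mul]; exact right_ne_zero_of_mul
  rw [coeffNorm_eq_of_support_subset h, coeffNorm, Finset.mul_sum]
  simp

theorem coeffNorm_monomial (n : ℕ) (c : ℂ) : coeffNorm (monomial n c) = ‖c‖ := by
  rw [coeffNorm_eq_of_support_subset (support_monomial_subset n c)]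
  simp

theorem coeffNorm_C (c : ℂ) : coeffNorm (C c) = ‖c‖ := coeffNorm_monomial 0 c

theorem coeffNorm_X : coeffNorm X = 1 := by
  simpa [monomial_one_one_eq_X] using coeffNorm_monomial 1 1

/-- For an `ℓ¹` norm, a linear map is controlled by its values on monomials. Submultiplicativity and
the bound for shifts both follow from this. -/
theorem coeffNorm_map_le (T : ℂ[X] →ₗ[ℂ] ℂ[X]) (B : ℝ) (p : ℂ[X])
    (hB : ∀ k ∈ p.support, coeffNorm (T (X ^ k)) ≤ B) :
    coeffNorm (T p) ≤ B * coeffNorm p := by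
  conv_lhs => rw [p.as_sum_support_C_mul_X_pow, map_sum]
  refine (coeffNorm_sum_le _ _).trans ?_
  rw [coeffNorm, Finset.mul_sum]
  refine Finset.sum_le_sum fun k hk => ?_
  rw [C_mul', map_smul, ← C_mul', coeffNorm_C_mul, mul_comm]
  gcongr
  exact hB k hk

theorem exists_coeffNorm_map_le (T : ℂ[X] →ₗ[ℂ] ℂ[X]) (N : ℕ) :
    ∃ B, 0 ≤ B ∧ ∀ p : ℂ[X], p.natDegree ≤ N → coeffNorm (T p) ≤ B * coeffNorm p := by
  refine ⟨∑ k ∈ Finset.range (N + 1), coeffNorm (T (X ^ k)),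
    Finset.sum_nonneg fun _ _ => coeffNorm_nonneg _, fun p hp => coeffNorm_map_le T _ p ?_⟩
  intro k hk
  exact Finset.single_le_sum (f := fun k => coeffNorm (T (X ^ k)))
    (fun _ _ => coeffNorm_nonneg _)
    (Finset.mem_range.2 (by have := le_natDegree_of_mem_supp k hk; omega))

theorem coeffNorm_mul_le (p q : ℂ[X]) : coeffNorm (p * q) ≤ coeffNorm p * coeffNorm q := by
  have hX : ∀ k (q : ℂ[X]), coeffNorm (q * X ^ k) ≤ coeffNorm q := by
    intro k q
    have := coeffNorm_map_le (LinearMap.mulRight ℂ (X ^ k : ℂ[X])) 1 q fun i _ => by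
      rw [LinearMap.mulRight_apply, ← pow_add, ← monomial_one_right_eq_X_pow, coeffNorm_monomial,
        norm_one]
    simpa using this
  rw [mul_comm (coeffNorm p)]
  refine coeffNorm_map_le (LinearMap.mulRight ℂ q) (coeffNorm q) p fun k _ => ?_
  rw [LinearMap.mulRight_apply, mul_comm]
  exact hX k q

theorem coeffNorm_pow_le (p : ℂ[X]) (k : ℕ) : coeffNorm (p ^ k) ≤ coeffNorm p ^ k := by
  induction k with
  | zero => simp [← C_1, coeffNorm_C, -map_one]
  | succ k ih =>
    rw [pow_succ, pow_succ]
    exact (coeffNorm_mul_le _ _).trans (by gcongr; exact coeffNorm_nonneg _)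

theorem coeffNorm_taylor_le (p : ℂ[X]) (b N : ℕ) (hp : p.natDegree ≤ N) :
    coeffNorm (taylor (b : ℂ) p) ≤ (1 + b : ℝ) ^ N * coeffNorm p := by
  refine coeffNorm_map_le _ _ p fun k hk => ?_
  rw [taylor_X_pow]
  refine (coeffNorm_pow_le _ _).trans ?_
  have h : coeffNorm (X + C (b : ℂ)) ≤ 1 + b := by
    refine (coeffNorm_add_le _ _).trans ?_
    rw [coeffNorm_X, coeffNorm_C, Complex.norm_natCast]
  calc _ ≤ (1 + b : ℝ) ^ k := by gcongr; exact coeffNorm_nonneg _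
    _ ≤ _ := by
      gcongr
      · linarith [(Nat.cast_nonneg b : (0 : ℝ) ≤ b)]
      · exact (le_natDegree_of_mem_supp k hk).trans hp

/-- The sequence of polynomials has at most exponential growth. -/
def GeometricGrowth (h : ℕ → ℂ[X]) : Prop :=
  ∃ C ρ : ℝ, 0 ≤ C ∧ 0 < ρ ∧ ∀ j, coeffNorm (h j) ≤ C * ρ ^ j

theorem exists_common_bound {f g : ℕ → ℝ} (hf : ∃ C ρ : ℝ, 0 ≤ C ∧ 0 < ρ ∧ ∀ j, f j ≤ C * ρ ^ j)
    (hg : ∃ C ρ : ℝ, 0 ≤ C ∧ 0 < ρ ∧ ∀ j, g j ≤ C * ρ ^ j) :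
    ∃ C ρ : ℝ, 0 ≤ C ∧ 0 < ρ ∧ ∀ j, f j + g j ≤ C * ρ ^ j := by
  obtain ⟨C, ρ, hC, hρ, h⟩ := hf
  obtain ⟨D, σ, hD, hσ, h'⟩ := hg
  refine ⟨C + D, ρ + σ, by positivity, by positivity, fun j => ?_⟩
  rw [add_mul]
  refine add_le_add ((h j).trans ?_) ((h' j).trans ?_) <;> gcongr <;> linarith

theorem GeometricGrowth.add {h k : ℕ → ℂ[X]} (hh : GeometricGrowth h) (hk : GeometricGrowth k) :
    GeometricGrowth (h + k) := by
  obtain ⟨C, ρ, hC, hρ, H⟩ := exists_common_bound hh hk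
  exact ⟨C, ρ, hC, hρ, fun j => (coeffNorm_add_le _ _).trans (H j)⟩

theorem exists_bound_sum {ι : Type*} (s : Finset ι) (f : ι → ℕ → ℝ)
    (hf : ∀ i ∈ s, ∃ C ρ : ℝ, 0 ≤ C ∧ 0 < ρ ∧ ∀ j, f i j ≤ C * ρ ^ j) :
    ∃ C ρ : ℝ, 0 ≤ C ∧ 0 < ρ ∧ ∀ j, ∑ i ∈ s, f i j ≤ C * ρ ^ j := by
  classical
  induction s using Finset.induction_on with
  | empty => exact ⟨0, 1, le_rfl, one_pos, by simp⟩
  | insert i s hi ih =>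
    simp only [Finset.sum_insert hi]
    exact exists_common_bound (hf i (Finset.mem_insert_self _ _))
      (ih fun k hk => hf k (Finset.mem_insert_of_mem hk))

theorem geometricGrowth_of_eventually_zero {h : ℕ → ℂ[X]} {A : ℕ} (hA : ∀ j, A < j → h j = 0) :
    GeometricGrowth h := by
  refine ⟨∑ j ∈ Finset.range (A + 1), coeffNorm (h j), 1,
    Finset.sum_nonneg fun _ _ => coeffNorm_nonneg _, one_pos, fun j => ?_⟩
  rw [one_pow, mul_one]
  by_cases hj : A < j
  · rw [hA j hj, coeffNorm_zero]
    exact Finset.sum_nonneg fun _ _ => coeffNorm_nonneg _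
  · exact Finset.single_le_sum (f := fun j => coeffNorm (h j)) (fun _ _ => coeffNorm_nonneg _)
      (Finset.mem_range.2 (by omega))

/-! ### Fuchsian operators and their expansions in `t` -/

namespace FuchsianOperator

theorem op_eq_symbolOp (L : FuchsianOperator) : L.op = symbolOp (symbol L.coeffs) :=
  diffOp_eq_symbolOp _

theorem eulerPart_eq_symbol (L : FuchsianOperator) : L.eulerPart = symbol L.coeffs 0 := by
  ext k
  simp [eulerPart, coeff_symbol, coeff_map]

theorem natDegree_eulerPart (L : FuchsianOperator) : L.eulerPart.natDegree = L.order :=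
  natDegree_map_of_leadingCoeff_ne_zero _ L.leading_ne_zero

theorem natDegree_symbol_le (L : FuchsianOperator) (j : ℕ) :
    (symbol L.coeffs j).natDegree ≤ L.order := by
  refine natDegree_le_iff_coeff_eq_zero.2 fun N hN => ?_
  rw [coeff_symbol, coeff_eq_zero_of_natDegree_lt hN, map_zero]

theorem geometricGrowth_symbol (L : FuchsianOperator) : GeometricGrowth (symbol L.coeffs) := by
  obtain ⟨C, ρ, hC, hρ, h⟩ := exists_bound_sum (Finset.range (L.order + 1))
    (fun k j => ‖PowerSeries.coeff j (L.coeffs.coeff k)‖)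
    fun k _ => (isHolomorphicGerm_iff _).1 (L.holomorphic k)
  refine ⟨C, ρ, hC, hρ, fun j => ?_⟩
  rw [coeffNorm_eq_of_support_subset (s := Finset.range (L.order + 1))]
  · simpa only [coeff_symbol] using h j
  · intro k hk
    have := le_natDegree_of_mem_supp k hk
    have := L.natDegree_symbol_le j
    exact Finset.mem_range.2 (by omega)

/-- A Fuchsian operator with given expansion `∑ tʲ hⱼ(ε)`. -/
theorem exists_of_symbol (h : ℕ → ℂ[X]) (h0 : h 0 ≠ 0)
    (hdeg : ∀ j, (h j).natDegree ≤ (h 0).natDegree) (hg : GeometricGrowth h) :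
    ∃ L : FuchsianOperator, L.op = symbolOp h ∧ L.eulerPart = h 0 ∧
      L.order = (h 0).natDegree := by
  set n := (h 0).natDegree with hn
  set a : (PowerSeries ℂ)[X] :=
    ∑ k ∈ Finset.range (n + 1), monomial k (PowerSeries.mk fun j => (h j).coeff k) with ha
  have hcoeff : ∀ k, a.coeff k = PowerSeries.mk fun j => (h j).coeff k := by
    intro k
    simp only [ha, finsetSum_coeff, coeff_monomial, Finset.sum_ite_eq', Finset.mem_range]
    split_ifs with hk
    · rfl
    · ext j
      rw [PowerSeries.coeff_mk, map_zero, coeff_eq_zero_of_natDegree_lt]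
      have := hdeg j
      omega
  have hsymb : symbol a = h := by
    ext j k
    rw [coeff_symbol, hcoeff, PowerSeries.coeff_mk]
  have hlc : PowerSeries.constantCoeff (a.coeff n) ≠ 0 := by
    rw [hcoeff, ← PowerSeries.coeff_zero_eq_constantCoeff_apply, PowerSeries.coeff_mk]
    simpa [hn] using h0
  have hdega : a.natDegree = n := by
    refine le_antisymm (natDegree_le_iff_coeff_eq_zero.2 fun N hN => ?_)
      (le_natDegree_of_ne_zero fun h => hlc (by rw [h, map_zero]))
    rw [hcoeff]
    ext j
    rw [PowerSeries.coeff_mk, map_zero, coeff_eq_zero_of_natDegree_lt]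
    have := hdeg j
    omega
  obtain ⟨C, ρ, hC, hρ, H⟩ := hg
  let L : FuchsianOperator :=
    { coeffs := a
      holomorphic := fun k => (isHolomorphicGerm_iff _).2 ⟨C, ρ, hC, hρ, fun j => by
        rw [hcoeff, PowerSeries.coeff_mk]
        exact (norm_coeff_le_coeffNorm _ _).trans (H j)⟩
      leading_ne_zero := by rwa [leadingCoeff, hdega] }
  refine ⟨L, ?_, ?_, hdega⟩
  · rw [op_eq_symbolOp]; exact congrArg _ hsymb
  · rw [eulerPart_eq_symbol]; exact congrFun hsymb 0

end FuchsianOperator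

/-! ### Products of operators of order one -/

/-- The interior terms of `skewMul`. -/
def skewInterior (m h : ℕ → ℂ[X]) (j : ℕ) : ℂ[X] :=
  ∑ p ∈ Finset.HasAntidiagonal.antidiagonal j with p.1 ≠ 0 ∧ p.2 ≠ 0,
    taylor (p.2 : ℂ) (m p.1) * h p.2

theorem skewMul_zero (m h : ℕ → ℂ[X]) : skewMul m h 0 = m 0 * h 0 := by
  simp [skewMul]

/-- Isolates the two terms containing `m j` or `h j`, the unknowns of order `j`; for `j > 0` the
rest depends only on lower orders. -/
theorem skewMul_eq (m h : ℕ → ℂ[X]) {j : ℕ} (hj : j ≠ 0) :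
    skewMul m h j = m j * h 0 + taylor (j : ℂ) (m 0) * h j + skewInterior m h j := by
  have hset : Finset.HasAntidiagonal.antidiagonal j = insert (j, 0) (insert (0, j)
      ((Finset.HasAntidiagonal.antidiagonal j).filter fun p => p.1 ≠ 0 ∧ p.2 ≠ 0)) := by
    ext ⟨a, b⟩
    simp
    omega
  rw [skewMul, hset, Finset.sum_insert (by simp [hj]), Finset.sum_insert (by simp)]
  simp only [Nat.cast_zero, taylor_zero, skewInterior]
  ring

theorem skewInterior_congr {m h m' h' : ℕ → ℂ[X]} {j : ℕ} (hm : ∀ i < j, m i = m' i)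
    (hh : ∀ i < j, h i = h' i) : skewInterior m h j = skewInterior m' h' j := by
  refine Finset.sum_congr rfl fun p hp => ?_
  simp only [Finset.mem_filter, Finset.HasAntidiagonal.mem_antidiagonal] at hp
  rw [hm p.1 (by omega), hh p.2 (by omega)]

theorem natDegree_skewInterior_le {m h : ℕ → ℂ[X]} {a b j : ℕ}
    (hm : ∀ i < j, i ≠ 0 → (m i).natDegree ≤ a) (hh : ∀ i < j, i ≠ 0 → (h i).natDegree ≤ b) :
    (skewInterior m h j).natDegree ≤ a + b := by
  refine natDegree_sum_le_of_forall_le _ _ fun p hp => ?_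
  simp only [Finset.mem_filter, Finset.HasAntidiagonal.mem_antidiagonal] at hp
  refine natDegree_mul_le_of_le ?_ (hh _ (by omega) hp.2.2)
  rw [natDegree_taylor]
  exact hm _ (by omega) hp.2.1

/-- The expansion of `ε - μ + ∑_{j > 0} cⱼ tʲ`. -/
def firstOrderSymbol (μ : ℂ) (c : ℕ → ℂ) (j : ℕ) : ℂ[X] :=
  if j = 0 then X - C μ else C (c j)

theorem firstOrderSymbol_zero (μ : ℂ) (c : ℕ → ℂ) : firstOrderSymbol μ c 0 = X - C μ := if_pos rfl

theorem firstOrderSymbol_of_ne_zero (μ : ℂ) (c : ℕ → ℂ) {j : ℕ} (hj : j ≠ 0) :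
    firstOrderSymbol μ c j = C (c j) := if_neg hj

/-- The symbol ignores the entry of index `0`, so `r` must have no constant term. -/
theorem symbolOp_firstOrderSymbol (μ : ℂ) (r : ℂ[X]) (hr : r.coeff 0 = 0) :
    symbolOp (firstOrderSymbol μ r.coeff) =
      eulerOp - mulOp (PowerSeries.C μ) + mulOp (r : PowerSeries ℂ) := by
  ext u N
  rw [coeff_symbolOp, LinearMap.add_apply, LinearMap.sub_apply, map_add, map_sub]
  have h1 : PowerSeries.coeff N (eulerOp u) = N * PowerSeries.coeff N u := by
    simpa using coeff_eulerOp_pow 1 u N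
  have h2 : PowerSeries.coeff N (mulOp (PowerSeries.C μ) u) = μ * PowerSeries.coeff N u := by
    simp [mulOp]
  have h3 : PowerSeries.coeff N (mulOp (r : PowerSeries ℂ) u) =
      ∑ p ∈ Finset.HasAntidiagonal.antidiagonal N, r.coeff p.1 * PowerSeries.coeff p.2 u := by
    simp [mulOp, PowerSeries.coeff_mul]
  rw [h1, h2, h3]
  have h4 : ((N : ℂ) - μ) * PowerSeries.coeff N u =
      ∑ p ∈ Finset.HasAntidiagonal.antidiagonal N,
        if p = (0, N) then ((N : ℂ) - μ) * PowerSeries.coeff N u else 0 := by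
    rw [Finset.sum_ite_eq' _ _ (fun _ => ((N : ℂ) - μ) * PowerSeries.coeff N u), if_pos (by simp)]
  rw [← sub_mul, h4, ← Finset.sum_add_distrib]
  refine Finset.sum_congr rfl fun ⟨a, b⟩ hp => ?_
  rw [Finset.HasAntidiagonal.mem_antidiagonal] at hp
  rcases eq_or_ne a 0 with rfl | ha
  · obtain rfl : b = N := by simpa using hp
    simp [firstOrderSymbol_zero, hr]
  · simp [firstOrderSymbol_of_ne_zero _ _ ha, ha]

/-- The polynomial with the roots `lam i`. -/
def rootPoly {n : ℕ} (lam : Fin n → ℂ) : ℂ[X] := ∏ i, (X - C (lam i))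

theorem rootPoly_succ {n : ℕ} (lam : Fin (n + 1) → ℂ) :
    rootPoly lam = rootPoly (fun i : Fin n => lam i.castSucc) * (X - C (lam (Fin.last n))) :=
  Fin.prod_univ_castSucc _

theorem monic_rootPoly {n : ℕ} (lam : Fin n → ℂ) : (rootPoly lam).Monic :=
  monic_prod_of_monic _ _ fun i _ => monic_X_sub_C (lam i)

theorem natDegree_rootPoly {n : ℕ} (lam : Fin n → ℂ) : (rootPoly lam).natDegree = n := by
  simp [rootPoly, natDegree_prod_of_monic _ _ fun i _ => monic_X_sub_C (lam i)]

/-- The expansion of `(ε - λ₁ + r₁) ⋯ (ε - λₙ + rₙ)` with `rᵢ = ∑_{j > 0} cᵢⱼ tʲ`. -/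
def reducibleSymbol : ∀ {n : ℕ}, (Fin n → ℂ) → (Fin n → ℕ → ℂ) → ℕ → ℂ[X]
  | 0, _, _ => fun j => if j = 0 then 1 else 0
  | n + 1, lam, c =>
    skewMul (reducibleSymbol (fun i : Fin n => lam i.castSucc) fun i : Fin n => c i.castSucc)
      (firstOrderSymbol (lam (Fin.last n)) (c (Fin.last n)))

theorem symbolOp_reducibleSymbol {n : ℕ} (lam : Fin n → ℂ) (r : Fin n → ℂ[X])
    (hr : ∀ i, (r i).coeff 0 = 0) :
    symbolOp (reducibleSymbol lam fun i => (r i).coeff) = reducibleOp lam r := by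
  induction n with
  | zero =>
    ext u N
    simp only [reducibleSymbol, coeff_symbolOp, reducibleOp, List.ofFn_zero, List.prod_nil,
      Module.End.one_apply]
    rw [Finset.sum_eq_single (0, N)]
    · simp
    · rintro ⟨a, b⟩ hp hne
      rw [Finset.HasAntidiagonal.mem_antidiagonal] at hp
      have ha : a ≠ 0 := by
        rintro rfl
        exact hne (by simpa using hp)
      simp [ha]
    · simp
  | succ n ih =>
    rw [reducibleSymbol, symbolOp_skewMul, symbolOp_firstOrderSymbol _ _ (hr _),
      ih (fun i => lam i.castSucc) (fun i => r i.castSucc) fun i => hr _, reducibleOp, reducibleOp,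
      List.ofFn_succ', List.prod_concat]

theorem reducibleSymbol_zero {n : ℕ} (lam : Fin n → ℂ) (c : Fin n → ℕ → ℂ) :
    reducibleSymbol lam c 0 = rootPoly lam := by
  induction n with
  | zero => simp [reducibleSymbol, rootPoly]
  | succ n ih => rw [reducibleSymbol, skewMul_zero, ih, firstOrderSymbol_zero, rootPoly_succ]

theorem reducibleSymbol_congr {n : ℕ} (lam : Fin n → ℂ) {c c' : Fin n → ℕ → ℂ} {j : ℕ}
    (h : ∀ i, ∀ k ≤ j, c i k = c' i k) : reducibleSymbol lam c j = reducibleSymbol lam c' j := by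
  induction n generalizing j with
  | zero => rfl
  | succ n ih =>
    simp only [reducibleSymbol, skewMul]
    refine Finset.sum_congr rfl fun p hp => ?_
    have hp' := Finset.HasAntidiagonal.mem_antidiagonal.1 hp
    rw [ih (c := fun i => c i.castSucc) (c' := fun i => c' i.castSucc) _
      fun i k hk => h _ k (by omega), firstOrderSymbol, firstOrderSymbol, h _ p.2 (by omega)]

theorem natDegree_firstOrderSymbol_le (μ : ℂ) (c : ℕ → ℂ) (j : ℕ) :
    (firstOrderSymbol μ c j).natDegree ≤ 1 := by
  rw [firstOrderSymbol]
  split_ifs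
  · exact natDegree_X_sub_C_le μ
  · simp

theorem natDegree_reducibleSymbol_le {n : ℕ} (lam : Fin n → ℂ) (c : Fin n → ℕ → ℂ) (j : ℕ) :
    (reducibleSymbol lam c j).natDegree ≤ n := by
  induction n generalizing j with
  | zero => simp only [reducibleSymbol]; split_ifs <;> simp
  | succ n ih =>
    rw [reducibleSymbol, skewMul]
    refine natDegree_sum_le_of_forall_le _ _ fun p _ => ?_
    refine natDegree_mul_le_of_le ?_ (natDegree_firstOrderSymbol_le _ _ _)
    rw [natDegree_taylor]
    exact ih _ _ _

theorem exists_forall_reducibleSymbol_eq_zero {n : ℕ} (lam : Fin n → ℂ) (c : Fin n → ℕ → ℂ)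
    {B : ℕ} (hc : ∀ i, ∀ j, B < j → c i j = 0) :
    ∃ A, ∀ j, A < j → reducibleSymbol lam c j = 0 := by
  induction n with
  | zero => exact ⟨0, fun j hj => if_neg hj.ne'⟩
  | succ n ih =>
    obtain ⟨A, hA⟩ := ih (fun i => lam i.castSucc) (fun i => c i.castSucc) fun i => hc _
    refine ⟨A + B, fun j hj => ?_⟩
    rw [reducibleSymbol, skewMul]
    refine Finset.sum_eq_zero fun p hp => ?_
    have hp' := Finset.HasAntidiagonal.mem_antidiagonal.1 hp
    by_cases h : A < p.1
    · rw [hA _ h, map_zero, zero_mul]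
    · rw [firstOrderSymbol_of_ne_zero _ _ (by omega), hc _ _ (by omega), C_0, mul_zero]

/-- The effect on the coefficient of `tʲ` in `(ε - λ₁ + r₁) ⋯ (ε - λₙ + rₙ)` of adding `δᵢ tʲ` to
each `rᵢ`. -/
def firstVariation : ∀ {n : ℕ}, (Fin n → ℂ) → ℕ → (Fin n → ℂ) → ℂ[X]
  | 0, _, _, _ => 0
  | n + 1, lam, j, δ =>
    C (δ (Fin.last n)) * taylor (j : ℂ) (rootPoly fun i : Fin n => lam i.castSucc) +
      (X - C (lam (Fin.last n))) *
        firstVariation (fun i : Fin n => lam i.castSucc) j fun i : Fin n => δ i.castSucc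

theorem natDegree_firstVariation_le {n : ℕ} (lam : Fin n → ℂ) (j : ℕ) (δ : Fin n → ℂ) :
    (firstVariation lam j δ).natDegree ≤ n := by
  induction n with
  | zero => simp [firstVariation]
  | succ n ih =>
    refine (natDegree_add_le_of_degree_le (n := n + 1) ?_ ?_)
    · refine (natDegree_C_mul_le _ _).trans ?_
      rw [natDegree_taylor, natDegree_rootPoly]
      omega
    · rw [add_comm n]
      exact natDegree_mul_le_of_le (natDegree_X_sub_C_le _) (ih _ _)

/-- The coefficient of `tʲ` is exactly affine in the entries of index `j`: a product of two of them
would have order at least `2j > j`. -/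
theorem reducibleSymbol_eq_add_firstVariation {n : ℕ} (lam : Fin n → ℂ) {c c' : Fin n → ℕ → ℂ}
    {j : ℕ} (hj : j ≠ 0) (h : ∀ i, ∀ k < j, c' i k = c i k) :
    reducibleSymbol lam c' j =
      reducibleSymbol lam c j + firstVariation lam j fun i => c' i j - c i j := by
  induction n with
  | zero => simp [reducibleSymbol, firstVariation]
  | succ n ih =>
    rw [reducibleSymbol, reducibleSymbol, skewMul_eq _ _ hj, skewMul_eq _ _ hj,
      ih (fun i => lam i.castSucc) (c := fun i => c i.castSucc) fun i => h _,
      skewInterior_congr (m' := reducibleSymbol (fun i : Fin n => lam i.castSucc)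
        fun i : Fin n => c i.castSucc) (h' := firstOrderSymbol (lam (Fin.last n)) (c (Fin.last n)))
        (fun i hi => reducibleSymbol_congr _ fun l k hk => h _ _ (by omega))
        (fun i hi => by rw [firstOrderSymbol, firstOrderSymbol, h _ _ hi]),
      reducibleSymbol_zero, reducibleSymbol_zero, firstOrderSymbol_zero, firstOrderSymbol_zero,
      firstOrderSymbol_of_ne_zero _ _ hj, firstOrderSymbol_of_ne_zero _ _ hj, firstVariation,
      C_sub]
    ring

/-! ### The homological equation -/

/-- The resonant directions of variation suffice modulo a divisor of the Euler part. -/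
theorem exists_dvd_sub_firstVariation {n : ℕ} (lam : Fin n → ℂ) {j : ℕ}
    (hlam : ∀ i k, lam k = lam i + j → i < k) {d : ℂ[X]} (hd : d ∣ rootPoly lam) (q : ℂ[X]) :
    ∃ δ : Fin n → ℂ, (∀ i, ¬ d.IsRoot (lam i) → δ i = 0) ∧ d ∣ q - firstVariation lam j δ := by
  induction n generalizing d q with
  | zero =>
    refine ⟨0, fun _ _ => rfl, ?_⟩
    have : IsUnit d := isUnit_of_dvd_one (by simpa [rootPoly] using hd)
    exact this.dvd
  | succ n ih =>
    have hlam' : ∀ i k : Fin n, lam k.castSucc = lam i.castSucc + j → i < k :=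
      fun i k h => Fin.castSucc_lt_castSucc_iff.1 (hlam _ _ h)
    rw [rootPoly_succ] at hd
    set μ := lam (Fin.last n) with hμ
    by_cases hroot : d.IsRoot μ
    · obtain ⟨e, rfl⟩ := dvd_iff_isRoot.2 hroot
      have he : e ∣ rootPoly fun i : Fin n => lam i.castSucc := by
        rw [mul_comm] at hd
        exact (mul_dvd_mul_iff_right (X_sub_C_ne_zero μ)).1 hd
      set g := taylor (j : ℂ) (rootPoly fun i : Fin n => lam i.castSucc) with hg
      -- Here the ordering enters: a zero of `g` at `μ` would give an earlier root equal to `μ + j`,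
      -- which should come after `μ`. So the last `δ` can be chosen to make the remainder vanish at
      -- `μ`, and a factor `X - μ` cancels.
      have hgμ : g.eval μ ≠ 0 := by
        rw [hg, taylor_eval, rootPoly, eval_prod, Finset.prod_ne_zero_iff]
        intro i _ h0
        rw [eval_sub, eval_X, eval_C, sub_eq_zero] at h0
        have := hlam (Fin.last n) i.castSucc h0.symm
        exact absurd this (Fin.le_last _).not_gt
      obtain ⟨q', hq'⟩ : X - C μ ∣ q - C (q.eval μ / g.eval μ) * g := by
        rw [dvd_iff_isRoot, IsRoot, eval_sub, eval_mul, eval_C, div_mul_cancel₀ _ hgμ, sub_self]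
      obtain ⟨δ, hδ, hdvd⟩ := ih (fun i => lam i.castSucc) hlam' he q'
      refine ⟨Fin.snoc δ (q.eval μ / g.eval μ), fun i => ?_, ?_⟩
      · refine Fin.lastCases ?_ (fun i => ?_) i
        · intro h; exact absurd hroot h
        · intro h
          rw [Fin.snoc_castSucc]
          refine hδ i fun h' => h ?_
          rw [IsRoot, eval_mul, h'.eq_zero, mul_zero]
      · simp only [firstVariation, Fin.snoc_last, Fin.snoc_castSucc]
        rw [← hg, ← sub_sub, hq', ← mul_sub]
        exact mul_dvd_mul_left _ hdvd
    · have hcop : IsCoprime (X - C μ) d :=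
        ((irreducible_X_sub_C μ).coprime_iff_not_dvd).2 fun h => hroot (dvd_iff_isRoot.1 h)
      obtain ⟨u, v, huv⟩ := hcop
      -- As `d` is coprime to `X - μ`, it divides the product of the other factors, and `u` inverts
      -- `X - μ` modulo `d`. So the last `δ` can be zero and the target becomes `u * q`.
      obtain ⟨δ, hδ, hdvd⟩ := ih (fun i => lam i.castSucc) hlam'
        (IsCoprime.dvd_of_dvd_mul_right ⟨v, u, by rw [add_comm, huv]⟩ hd) (u * q)
      refine ⟨Fin.snoc δ 0, fun i => ?_, ?_⟩
      · refine Fin.lastCases ?_ (fun i => ?_) i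
        · simp
        · simpa using hδ i
      · simp only [firstVariation, Fin.snoc_last, Fin.snoc_castSucc]
        have : q - (C 0 * taylor (j : ℂ) (rootPoly fun i : Fin n => lam i.castSucc) +
            (X - C μ) * firstVariation (fun i : Fin n => lam i.castSucc) j δ) =
            (X - C μ) * (u * q - firstVariation (fun i : Fin n => lam i.castSucc) j δ)
              + d * (v * q) := by
          rw [C_0]
          linear_combination (-q) * huv
        rw [this]
        exact dvd_add (hdvd.mul_left _) (dvd_mul_right _ _)

/-- The homological equation: after a correction by resonant terms, every right hand side can be
represented by operators of order less than `n`. -/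
theorem exists_homological_solution {n : ℕ} (hn : n ≠ 0) (lam : Fin n → ℂ) {j : ℕ}
    (hlam : ∀ i k, lam k = lam i + j → i < k) {α : ℂ} (hα : α ≠ 0) {F : ℂ[X]}
    (hF : F.natDegree < 2 * n) :
    ∃ (δ : Fin n → ℂ) (h k : ℂ[X]), (∀ i, ¬ (rootPoly lam).IsRoot (lam i + j) → δ i = 0) ∧
      h.natDegree < n ∧ k.natDegree < n ∧
      C α * firstVariation lam j δ + taylor (j : ℂ) (rootPoly lam) * h
        - k * (C α * rootPoly lam) = F := by
  set P := rootPoly lam with hP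
  have hPm : P.Monic := monic_rootPoly lam
  have hPd : P.natDegree = n := natDegree_rootPoly lam
  set d := EuclideanDomain.gcd P (taylor (j : ℂ) P) with hd
  obtain ⟨δ, hδ, s, hs⟩ := exists_dvd_sub_firstVariation lam hlam
    (EuclideanDomain.gcd_dvd_left P (taylor (j : ℂ) P)) (C α⁻¹ * F)
  have hα' : C α * C α⁻¹ = (1 : ℂ[X]) := by rw [← C_mul, mul_inv_cancel₀ hα, C_1]
  set u := EuclideanDomain.gcdA P (taylor (j : ℂ) P)
  set v := EuclideanDomain.gcdB P (taylor (j : ℂ) P)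
  have hbez : d = P * u + taylor (j : ℂ) P * v := EuclideanDomain.gcd_eq_gcd_ab _ _
  -- Bézout gives the solution `h = G`, `k = -u s`. Replacing `G` by its remainder modulo `P` lowers
  -- the degree of `h`; the quotient is moved into `k`, which becomes `-w`.
  set G := C α * v * s with hG
  have hGd : G %ₘ P + P * (G /ₘ P) = G := modByMonic_add_div G P
  set h := G %ₘ P with hh
  have hhdeg : h.natDegree < n := by
    rw [← hPd]
    exact natDegree_modByMonic_lt _ hPm fun h1 => hn (by rw [← hPd, h1, natDegree_one])
  set w := u * s + C α⁻¹ * taylor (j : ℂ) P * (G /ₘ P) with hw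
  have key : C α * firstVariation lam j δ + taylor (j : ℂ) P * h - (-w) * (C α * P) = F := by
    rw [← hd] at hs
    linear_combination (-C α) * hs + (F + taylor (j : ℂ) P * P * (G /ₘ P)) * hα'
      + taylor (j : ℂ) P * hGd - C α * s * hbez
  refine ⟨δ, h, -w, fun i hi => hδ i fun h' => hi ?_, hhdeg, ?_, key⟩
  · have := h'.dvd (EuclideanDomain.gcd_dvd_right P (taylor (j : ℂ) P))
    rwa [IsRoot, taylor_eval] at this
  -- The bound on `k` comes from the equation: every other term has degree at most `2n - 1`, while
  -- `P` has degree `n`.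
  · by_contra hcon
    push Not at hcon
    have h1 : -w * P * C α = C α * firstVariation lam j δ + taylor (j : ℂ) P * h - F := by
      linear_combination -key
    have h2 : (-w * P * C α).natDegree = (-w).natDegree + n := by
      have hw0 : -w ≠ 0 := by
        intro h0
        rw [h0, natDegree_zero] at hcon
        omega
      rw [natDegree_mul_C hα, natDegree_mul hw0 hPm.ne_zero, hPd]
    have h3 : (C α * firstVariation lam j δ + taylor (j : ℂ) P * h - F).natDegree ≤ 2 * n - 1 := by
      have h4 : (C α * firstVariation lam j δ).natDegree ≤ 2 * n - 1 :=
        ((natDegree_C_mul_le _ _).trans (natDegree_firstVariation_le _ _ _)).trans (by omega)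
      have h5 : (taylor (j : ℂ) P * h).natDegree ≤ 2 * n - 1 := by
        refine natDegree_mul_le.trans ?_
        rw [natDegree_taylor, hPd]
        omega
      have h6 : F.natDegree ≤ 2 * n - 1 := by omega
      exact (natDegree_sub_le_of_le (natDegree_add_le_of_degree_le h4 h5) h6).trans
        (max_self _).le
    rw [← h1, h2] at h3
    omega

/-! ### The formal equivalence -/

/-- Recursive choice: the condition at `j` sees only the entries up to `j`, so later updates cannot
spoil it and the diagonal of the successive approximations works. -/
theorem exists_seq_of_local_extension {S : Type*} [Inhabited S] (P : ℕ → (ℕ → S) → Prop)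
    (hloc : ∀ j f g, (∀ i ≤ j, f i = g i) → P j f → P j g)
    (hstep : ∀ j f, (∀ i < j, P i f) → ∃ x, P j (Function.update f j x)) :
    ∃ f, ∀ j, P j f := by
  classical
  choose! x hx using hstep
  let G : ℕ → ℕ → S := fun N => Nat.rec (fun _ => default) (fun j f => Function.update f j (x j f)) N
  have hG : ∀ N, G (N + 1) = Function.update (G N) N (x N (G N)) := fun _ => rfl
  have hstab : ∀ N i, i < N → G N i = G (i + 1) i := by
    intro N i hi
    induction N, (Nat.succ_le_of_lt hi) using Nat.le_induction with
    | base => rfl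
    | succ N hN ih =>
      rw [hG, Function.update_of_ne (by omega), ih (by omega)]
  have hP : ∀ N, ∀ i < N, P i (G N) := by
    intro N
    induction N with
    | zero => intro i hi; omega
    | succ N ih =>
      intro i hi
      rcases Nat.lt_succ_iff_lt_or_eq.1 hi with h | rfl
      · refine hloc i (G N) _ (fun k hk => ?_) (ih i h)
        rw [hG, Function.update_of_ne (by omega)]
      · rw [hG]
        exact hx _ _ ih
  refine ⟨fun i => G (i + 1) i, fun j => hloc j (G (j + 1)) _ (fun i hi => ?_) (hP (j + 1) j (by omega))⟩
  exact hstab (j + 1) i (by omega)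

theorem skewMul_congr {m h m' h' : ℕ → ℂ[X]} {j : ℕ} (hm : ∀ i ≤ j, m i = m' i)
    (hh : ∀ i ≤ j, h i = h' i) : skewMul m h j = skewMul m' h' j := by
  refine Finset.sum_congr rfl fun p hp => ?_
  have := Finset.HasAntidiagonal.mem_antidiagonal.1 hp
  rw [hm p.1 (by omega), hh p.2 (by omega)]

/-- Each order is one homological equation. The bounds `deg hⱼ, deg kⱼ < n` belong to the induction
because they keep the next right-hand side below degree `2n`. -/
theorem exists_formal_equivalence {n : ℕ} (hn : n ≠ 0) (lam : Fin n → ℂ)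
    (hlam : ∀ (i k : Fin n) (j : ℕ), 0 < j → lam k = lam i + j → i < k) {α : ℂ} (hα : α ≠ 0)
    (p : ℕ → ℂ[X]) (hp0 : p 0 = C α * rootPoly lam) (hp : ∀ j, (p j).natDegree ≤ n) :
    ∃ (c : Fin n → ℕ → ℂ) (h k : ℕ → ℂ[X]),
      (∀ i j, c i j ≠ 0 → 0 < j ∧ (rootPoly lam).IsRoot (lam i + j)) ∧
      h 0 = C α ∧ k 0 = 1 ∧ (∀ j, (h j).natDegree < n) ∧ (∀ j, (k j).natDegree < n) ∧
      ∀ j, skewMul (reducibleSymbol lam c) h j = skewMul k p j := by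
  let c : (ℕ → (Fin n → ℂ) × ℂ[X] × ℂ[X]) → Fin n → ℕ → ℂ := fun x i j => (x j).1 i
  let h : (ℕ → (Fin n → ℂ) × ℂ[X] × ℂ[X]) → ℕ → ℂ[X] := fun x j => (x j).2.1
  let k : (ℕ → (Fin n → ℂ) × ℂ[X] × ℂ[X]) → ℕ → ℂ[X] := fun x j => (x j).2.2
  suffices hS : ∃ x : ℕ → (Fin n → ℂ) × ℂ[X] × ℂ[X], ∀ j,
      (∀ i, c x i j ≠ 0 → 0 < j ∧ (rootPoly lam).IsRoot (lam i + j)) ∧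
      (j = 0 → h x j = C α ∧ k x j = 1) ∧ (h x j).natDegree < n ∧ (k x j).natDegree < n ∧
      skewMul (reducibleSymbol lam (c x)) (h x) j = skewMul (k x) p j by
    obtain ⟨x, hx⟩ := hS
    exact ⟨c x, h x, k x, fun i j => (hx j).1 i, ((hx 0).2.1 rfl).1, ((hx 0).2.1 rfl).2,
      fun j => (hx j).2.2.1, fun j => (hx j).2.2.2.1, fun j => (hx j).2.2.2.2⟩
  apply exists_seq_of_local_extension
  · intro j x y hxy hx
    have h1 : ∀ i ≤ j, h x i = h y i := fun i hi => by simp only [h, hxy i hi]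
    have h2 : ∀ i ≤ j, k x i = k y i := fun i hi => by simp only [k, hxy i hi]
    have h3 : ∀ l, ∀ i ≤ j, c x l i = c y l i := fun l i hi => by simp only [c, hxy i hi]
    rw [← h1 j le_rfl, ← h2 j le_rfl,
      ← skewMul_congr (fun i hi => reducibleSymbol_congr lam fun l a ha => h3 l a (by omega)) h1,
      ← skewMul_congr h2 fun _ _ => rfl]
    simp only [← h3 _ j le_rfl]
    exact hx
  · intro j x hx
    rcases eq_or_ne j 0 with rfl | hj
    · refine ⟨(0, C α, 1), ?_, ?_, ?_, ?_, ?_⟩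
      · simp [c]
      · simp [h, k]
      · simpa [h] using Nat.pos_of_ne_zero hn
      · simpa [k] using Nat.pos_of_ne_zero hn
      · simp [skewMul_zero, reducibleSymbol_zero, h, k, hp0, mul_comm]
    · have hj0 : 0 < j := Nat.pos_of_ne_zero hj
      obtain ⟨hh0, hk0⟩ := (hx 0 hj0).2.1 rfl
      set m := reducibleSymbol lam (c x) with hm
      -- The update by `0` gives the coefficient of `M` with all order-`j` corrections switched off,
      -- the base point for the first variation.
      set F := p j + skewInterior (k x) p j - skewInterior m (h x) j
        - C α * reducibleSymbol lam (c (Function.update x j 0)) j with hF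
      have hFd : F.natDegree < 2 * n := by
        have e1 : (p j).natDegree ≤ 2 * n - 1 := (hp j).trans (by omega)
        have e2 : (skewInterior (k x) p j).natDegree ≤ 2 * n - 1 :=
          (natDegree_skewInterior_le (a := n - 1) (b := n)
            (fun i hi _ => Nat.le_sub_one_of_lt (hx i hi).2.2.2.1) fun i _ _ => hp i).trans
            (by omega)
        have e3 : (skewInterior m (h x) j).natDegree ≤ 2 * n - 1 :=
          (natDegree_skewInterior_le (a := n) (b := n - 1)
            (fun i _ _ => natDegree_reducibleSymbol_le _ _ _)
            fun i hi _ => Nat.le_sub_one_of_lt (hx i hi).2.2.1).trans (by omega)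
        have e4 : (C α * reducibleSymbol lam (c (Function.update x j 0)) j).natDegree ≤ 2 * n - 1 :=
          ((natDegree_C_mul_le _ _).trans (natDegree_reducibleSymbol_le _ _ _)).trans (by omega)
        have e5 : F.natDegree ≤ _ := natDegree_sub_le_of_le
          (natDegree_sub_le_of_le (natDegree_add_le_of_degree_le e1 e2) e3) e4
        simp only [max_self] at e5
        omega
      obtain ⟨δ, h', k', hδ, hh', hk', hsol⟩ :=
        exists_homological_solution hn lam (fun i k => hlam i k j hj0) hα hFd
      refine ⟨(δ, h', k'), ?_, fun h0 => absurd h0 hj, ?_, ?_, ?_⟩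
      · intro i hi
        refine ⟨hj0, by_contra fun hr => hi ?_⟩
        simpa [c] using hδ i hr
      · simpa [h] using hh'
      · simpa [k] using hk'
      · have hlt : ∀ y, ∀ i < j, Function.update x j y i = x i :=
          fun y i hi => Function.update_of_ne (by omega) _ _
        have hm' : reducibleSymbol lam (c (Function.update x j (δ, h', k'))) j =
            reducibleSymbol lam (c (Function.update x j 0)) j + firstVariation lam j δ := by
          rw [reducibleSymbol_eq_add_firstVariation lam (c := c (Function.update x j 0)) hj]
          · congr 2
            funext i
            simp [c]
          · intro i a ha
            simp only [c, hlt _ a ha]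
        rw [skewMul_eq _ _ hj, skewMul_eq _ _ hj, hm', reducibleSymbol_zero,
          skewInterior_congr (m' := m) (h' := h x)
            (fun i hi => reducibleSymbol_congr _ fun l a ha => by
              simp only [c, hlt _ a (show a < j by omega)])
            (fun i hi => by simp only [h, hlt _ i hi]),
          skewInterior_congr (m := k (Function.update x j (δ, h', k'))) (m' := k x) (h' := p)
            (fun i hi => by simp only [k, hlt _ i hi]) (fun _ _ => rfl)]
        have a1 : h (Function.update x j (δ, h', k')) 0 = C α := by
          rw [← hh0]; simp only [h, hlt _ 0 hj0]
        have a2 : k (Function.update x j (δ, h', k')) 0 = 1 := by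
          rw [← hk0]; simp only [k, hlt _ 0 hj0]
        have a3 : h (Function.update x j (δ, h', k')) j = h' := by simp [h]
        have a4 : k (Function.update x j (δ, h', k')) j = k' := by simp [k]
        rw [a1, a2, a3, a4, hp0, taylor_one, C_1]
        linear_combination hsol

/-! ### Convergence of the formal equivalence -/

/-- With `σ = ρ (1 + C)` one has `C ρ = σ - ρ`, so the sum telescopes exactly. -/
theorem sum_antidiagonal_filter_geometric (C ρ : ℝ) (j : ℕ) :
    ∑ p ∈ Finset.HasAntidiagonal.antidiagonal j with p.1 ≠ 0, C * ρ ^ p.1 * (ρ * (1 + C)) ^ p.2 =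
      (ρ * (1 + C)) ^ j - ρ ^ j := by
  rw [Finset.sum_filter]
  rcases j with _ | j
  · simp
  · rw [Finset.Nat.sum_antidiagonal_succ]
    simp only [ne_eq, not_true_eq_false, if_false, zero_add, Nat.add_eq_zero_iff, one_ne_zero,
      and_false, not_false_eq_true, if_true]
    set σ := ρ * (1 + C) with hσ
    have h := geom_sum₂_mul ρ σ (j + 1)
    rw [Finset.Nat.sum_antidiagonal_eq_sum_range_succ (fun a b => C * ρ ^ (a + 1) * σ ^ b) j,
      ← neg_sub, ← h]
    have hs : ρ - σ = -(C * ρ) := by rw [hσ]; ring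
    rw [hs, mul_neg, neg_neg, Finset.sum_mul]
    refine Finset.sum_congr rfl fun i _ => ?_
    rw [Nat.add_sub_cancel]
    ring

/-- The rate `σ = ρ (1 + C)` makes `B σʲ` a supersolution of the recursion, by the preceding
identity. -/
theorem exists_geometric_bound_of_convolution {y q : ℕ → ℝ} (hy : ∀ j, 0 ≤ y j)
    (hq : ∃ C ρ : ℝ, 0 ≤ C ∧ 0 < ρ ∧ ∀ j, q j ≤ C * ρ ^ j) (J : ℕ)
    (h : ∀ j, J ≤ j → y j ≤ ∑ p ∈ Finset.HasAntidiagonal.antidiagonal j with p.1 ≠ 0,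
      q p.1 * y p.2) :
    ∃ C ρ : ℝ, 0 ≤ C ∧ 0 < ρ ∧ ∀ j, y j ≤ C * ρ ^ j := by
  obtain ⟨C, ρ, hC, hρ, hq⟩ := hq
  have hσ : 0 < ρ * (1 + C) := by positivity
  have hB : 0 ≤ ∑ i ∈ Finset.range J, y i / (ρ * (1 + C)) ^ i :=
    Finset.sum_nonneg fun i _ => div_nonneg (hy i) (by positivity)
  -- This constant dominates every `y i / σ ^ i` with `i < J`, where the recursion is not available.
  refine ⟨∑ i ∈ Finset.range J, y i / (ρ * (1 + C)) ^ i, ρ * (1 + C), hB, hσ, fun j => ?_⟩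
  induction j using Nat.strong_induction_on with
  | _ j ih =>
    set B := ∑ i ∈ Finset.range J, y i / (ρ * (1 + C)) ^ i with hBdef
    by_cases hj : J ≤ j
    · calc y j ≤ ∑ p ∈ Finset.HasAntidiagonal.antidiagonal j with p.1 ≠ 0, q p.1 * y p.2 := h j hj
        _ ≤ ∑ p ∈ Finset.HasAntidiagonal.antidiagonal j with p.1 ≠ 0,
            B * (C * ρ ^ p.1 * (ρ * (1 + C)) ^ p.2) := by
          refine Finset.sum_le_sum fun p hp => ?_
          rw [Finset.mem_filter, Finset.HasAntidiagonal.mem_antidiagonal] at hp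
          calc q p.1 * y p.2 ≤ (C * ρ ^ p.1) * (B * (ρ * (1 + C)) ^ p.2) :=
                mul_le_mul (hq _) (ih p.2 (by omega)) (hy _) (by positivity)
            _ = _ := by ring
        _ = B * ((ρ * (1 + C)) ^ j - ρ ^ j) := by
          rw [← Finset.mul_sum, sum_antidiagonal_filter_geometric]
        _ ≤ B * (ρ * (1 + C)) ^ j := by
          gcongr
          linarith [pow_pos hρ j]
    · rw [← div_le_iff₀ (by positivity)]
      exact Finset.single_le_sum (f := fun i => y i / (ρ * (1 + C)) ^ i)
        (fun i _ => div_nonneg (hy i) (by positivity)) (Finset.mem_range.2 (by omega))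

/-- On `ℂ[X]/(P)` each factor `X - λᵢ + j` of `P(X + j)` acts as the scalar `j` plus an operator of
norm at most `K`, independent of `j`. It therefore expands norms by at least `j - K`, and there are
`n` factors. -/
theorem exists_le_coeffNorm_modByMonic {n : ℕ} (hn : n ≠ 0) (lam : Fin n → ℂ) :
    ∃ (c : ℝ) (J : ℕ), 0 < c ∧ ∀ j, J ≤ j → ∀ v : ℂ[X], v.natDegree < n →
      c * ((1 + j : ℝ) ^ n * coeffNorm v) ≤
        coeffNorm ((taylor (j : ℂ) (rootPoly lam) * v) %ₘ rootPoly lam) := by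
  set P := rootPoly lam with hP
  have hPm : P.Monic := monic_rootPoly lam
  have hPd : P.natDegree = n := natDegree_rootPoly lam
  have hP1 : P ≠ 1 := fun h1 => hn (by rw [← hPd, h1, natDegree_one])
  choose B hB0 hB using fun i : Fin n => exists_coeffNorm_map_le
    ((modByMonicHom P).comp (LinearMap.mulLeft ℂ (X - C (lam i)))) n
  set K := ∑ i, B i with hK
  have hK0 : 0 ≤ K := Finset.sum_nonneg fun i _ => hB0 i
  have hBK : ∀ i, B i ≤ K := fun i =>
    Finset.single_le_sum (f := B) (fun i _ => hB0 i) (Finset.mem_univ i)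
  have key : ∀ (j : ℕ), K ≤ j → ∀ v : ℂ[X], v.natDegree < n → ∀ s : Finset (Fin n),
      (j - K) ^ s.card * coeffNorm v ≤
        coeffNorm (((∏ i ∈ s, (X - C (lam i) + C (j : ℂ))) * v) %ₘ P) := by
    intro j hj v hv s
    have hjK : 0 ≤ (j : ℝ) - K := sub_nonneg.2 hj
    have hlt : ∀ {w : ℂ[X]}, w.natDegree < n → w %ₘ P = w := fun {w} hw =>
      (modByMonic_eq_self_iff hPm).2 (degree_lt_degree (by rwa [hPd]))
    induction s using Finset.induction_on with
    | empty => simp [hlt hv]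
    | insert i s hi ih =>
      rw [Finset.card_insert_of_notMem hi, Finset.prod_insert hi, mul_assoc]
      set u := (∏ i ∈ s, (X - C (lam i) + C (j : ℂ))) * v
      set w := u %ₘ P with hw
      have hwd : w.natDegree < n := by
        rw [← hPd]
        exact natDegree_modByMonic_lt _ hPm hP1
      have h1 : ((X - C (lam i) + C (j : ℂ)) * u) %ₘ P =
          C (j : ℂ) * w + ((X - C (lam i)) * w) %ₘ P := by
        have h2 : ((X - C (lam i) + C (j : ℂ)) * u) %ₘ P =
            (C (j : ℂ) * w + (X - C (lam i)) * w) %ₘ P := by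
          refine modByMonic_eq_of_dvd_sub hPm ?_
          have h3 : P ∣ u - w := by
            rw [← neg_sub, dvd_neg]
            exact dvd_modByMonic_sub u P
          have h4 : (X - C (lam i) + C (j : ℂ)) * u - (C (j : ℂ) * w + (X - C (lam i)) * w) =
              (X - C (lam i) + C (j : ℂ)) * (u - w) := by ring
          rw [h4]
          exact h3.mul_left _
        rw [h2, add_modByMonic, hlt ((natDegree_C_mul_le _ _).trans_lt hwd)]
      have h5 : coeffNorm (((X - C (lam i)) * w) %ₘ P) ≤ K * coeffNorm w :=
        (hB i w hwd.le).trans (mul_le_mul_of_nonneg_right (hBK i) (coeffNorm_nonneg w))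
      have h6 : j * coeffNorm w ≤ coeffNorm (C (j : ℂ) * w + ((X - C (lam i)) * w) %ₘ P) +
          coeffNorm (((X - C (lam i)) * w) %ₘ P) := by
        have := coeffNorm_sub_le (C (j : ℂ) * w + ((X - C (lam i)) * w) %ₘ P)
          (((X - C (lam i)) * w) %ₘ P)
        rwa [add_sub_cancel_right, coeffNorm_C_mul, Complex.norm_natCast] at this
      rw [h1, pow_succ', mul_assoc]
      calc (j - K) * ((j - K) ^ s.card * coeffNorm v) ≤ (j - K) * coeffNorm w := by gcongr
        _ ≤ _ := by linarith
  -- `j ≥ 2K + 1` is equivalent to `j - K ≥ (1 + j)/2`.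
  refine ⟨(1 / 2) ^ n, ⌈2 * K + 1⌉₊, by positivity, fun j hj v hv => ?_⟩
  have hj' : 2 * K + 1 ≤ j := Nat.ceil_le.1 hj
  have hT : taylor (j : ℂ) P = ∏ i, (X - C (lam i) + C (j : ℂ)) := by
    rw [hP, rootPoly]
    refine (map_prod (taylorAlgHom (j : ℂ)) _ _).trans (Finset.prod_congr rfl fun i _ => ?_)
    rw [taylorAlgHom_apply, map_sub, taylor_X, taylor_C]
    ring
  have := key j (by linarith) v hv Finset.univ
  rw [hT]
  refine le_trans ?_ this
  rw [Finset.card_univ, Fintype.card_fin, ← mul_assoc, ← mul_pow]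
  have := coeffNorm_nonneg v
  gcongr
  linarith

/-- Division by a monic polynomial as a linear map. -/
def divByMonicHom (P : ℂ[X]) (hP : P.Monic) : ℂ[X] →ₗ[ℂ] ℂ[X] where
  toFun p := p /ₘ P
  map_add' p q := by
    refine (div_modByMonic_unique (p /ₘ P + q /ₘ P) (p %ₘ P + q %ₘ P) hP ⟨?_, ?_⟩).1
    · linear_combination modByMonic_add_div p P + modByMonic_add_div q P
    · exact (degree_add_le _ _).trans_lt
        (max_lt (degree_modByMonic_lt p hP) (degree_modByMonic_lt q hP))
  map_smul' c p := by
    refine (div_modByMonic_unique (c • (p /ₘ P)) (c • (p %ₘ P)) hP ⟨?_, ?_⟩).1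
    · rw [mul_smul_comm, ← smul_add, modByMonic_add_div]
    · exact (degree_smul_le _ _).trans_lt (degree_modByMonic_lt p hP)

/-- In `m_a(X + b) h_b` the shift costs `(1 + b)ⁿ`, precisely what inverting `P(X + b)` modulo `P`
gains for `h_b`. In `k_b(X + a) p_a` it costs `(1 + a)ⁿ`, harmless beside the geometric growth of
`p_a`. Hence the weighted quantity `y` below obeys a convolution inequality. -/
theorem geometricGrowth_of_skewMul_eq {n : ℕ} (hn : n ≠ 0) (lam : Fin n → ℂ) {α : ℂ} (hα : α ≠ 0)
    {m p h k : ℕ → ℂ[X]} (hm0 : m 0 = rootPoly lam) (hp0 : p 0 = C α * rootPoly lam)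
    (hmd : ∀ j, (m j).natDegree ≤ n)
    (hhd : ∀ j, (h j).natDegree < n) (hkd : ∀ j, (k j).natDegree < n)
    (hm : GeometricGrowth m) (hp : GeometricGrowth p)
    (heq : ∀ j, skewMul m h j = skewMul k p j) : GeometricGrowth h ∧ GeometricGrowth k := by
  set P := rootPoly lam with hP
  have hPm : P.Monic := monic_rootPoly lam
  have hPd : P.natDegree = n := natDegree_rootPoly lam
  set y : ℕ → ℝ := fun j : ℕ => (1 + j : ℝ) ^ n * coeffNorm (h j) + coeffNorm (k j) with hy
  have hy1 : ∀ j : ℕ, (1 + j : ℝ) ^ n * coeffNorm (h j) ≤ y j := fun j =>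
    le_add_of_nonneg_right (coeffNorm_nonneg _)
  have hy2 : ∀ j, coeffNorm (k j) ≤ y j := fun j =>
    le_add_of_nonneg_left (mul_nonneg (by positivity) (coeffNorm_nonneg _))
  have hy0 : ∀ j, 0 ≤ y j := fun j => (coeffNorm_nonneg _).trans (hy2 j)
  set q : ℕ → ℝ := fun a : ℕ => (1 + a : ℝ) ^ n * coeffNorm (p a) + coeffNorm (m a) with hq
  have hqg : ∃ C ρ : ℝ, 0 ≤ C ∧ 0 < ρ ∧ ∀ j, q j ≤ C * ρ ^ j := by
    refine exists_common_bound ?_ hm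
    obtain ⟨D, ρ, hD, hρ, hDp⟩ := hp
    refine ⟨D, 2 ^ n * ρ, hD, by positivity, fun j => ?_⟩
    have h1 : (1 + j : ℝ) ≤ 2 ^ j := by
      have := Nat.lt_two_pow_self (n := j)
      have h2 : 1 + j ≤ 2 ^ j := by omega
      exact_mod_cast h2
    calc (1 + j : ℝ) ^ n * coeffNorm (p j) ≤ (2 ^ j) ^ n * (D * ρ ^ j) := by
          gcongr
          · exact coeffNorm_nonneg _
          · exact hDp j
      _ = D * (2 ^ n * ρ) ^ j := by rw [mul_pow, ← pow_mul, ← pow_mul, mul_comm j n]; ring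
  set F : ℕ → ℂ[X] := fun j => taylor (j : ℂ) P * h j - k j * (C α * P) with hF
  have hFq : ∀ j, coeffNorm (F j) ≤
      ∑ p ∈ Finset.HasAntidiagonal.antidiagonal j with p.1 ≠ 0, q p.1 * y p.2 := by
    intro j
    have hsplit : ∀ f : ℕ × ℕ → ℂ[X], ∑ x ∈ Finset.HasAntidiagonal.antidiagonal j, f x =
        f (0, j) + ∑ x ∈ Finset.HasAntidiagonal.antidiagonal j with x.1 ≠ 0, f x := by
      intro f
      have hset : Finset.HasAntidiagonal.antidiagonal j = insert (0, j)
          ((Finset.HasAntidiagonal.antidiagonal j).filter fun p => p.1 ≠ 0) := by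
        ext ⟨a, b⟩
        simp
        omega
      conv_lhs => rw [hset]
      rw [Finset.sum_insert (by simp)]
    have h1 : skewMul m h j = taylor (j : ℂ) P * h j +
        ∑ x ∈ Finset.HasAntidiagonal.antidiagonal j with x.1 ≠ 0,
          taylor (x.2 : ℂ) (m x.1) * h x.2 := by
      rw [skewMul, hsplit, hm0]
    have h2 : skewMul k p j = k j * (C α * P) +
        ∑ x ∈ Finset.HasAntidiagonal.antidiagonal j with x.1 ≠ 0,
          taylor (x.1 : ℂ) (k x.2) * p x.1 := by
      rw [skewMul, ← Finset.Nat.sum_antidiagonal_swap]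
      simp only [Prod.fst_swap, Prod.snd_swap]
      rw [hsplit, hp0, Nat.cast_zero, taylor_zero]
    have h3 : F j = ∑ x ∈ Finset.HasAntidiagonal.antidiagonal j with x.1 ≠ 0,
        (taylor (x.1 : ℂ) (k x.2) * p x.1 - taylor (x.2 : ℂ) (m x.1) * h x.2) := by
      rw [Finset.sum_sub_distrib]
      linear_combination heq j - h1 + h2
    rw [h3]
    refine (coeffNorm_sum_le _ _).trans (Finset.sum_le_sum fun x _ => ?_)
    calc _ ≤ coeffNorm (taylor (x.1 : ℂ) (k x.2)) * coeffNorm (p x.1) +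
          coeffNorm (taylor (x.2 : ℂ) (m x.1)) * coeffNorm (h x.2) :=
          (coeffNorm_sub_le _ _).trans
            (add_le_add (coeffNorm_mul_le _ _) (coeffNorm_mul_le _ _))
      _ ≤ ((1 + x.1 : ℝ) ^ n * coeffNorm (k x.2)) * coeffNorm (p x.1) +
          ((1 + x.2 : ℝ) ^ n * coeffNorm (m x.1)) * coeffNorm (h x.2) := by
          have := coeffNorm_nonneg (p x.1)
          have := coeffNorm_nonneg (h x.2)
          gcongr
          · exact coeffNorm_taylor_le _ _ _ (hkd _).le
          · exact coeffNorm_taylor_le _ _ _ (hmd _)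
      _ = ((1 + x.1 : ℝ) ^ n * coeffNorm (p x.1)) * coeffNorm (k x.2) +
          coeffNorm (m x.1) * ((1 + x.2 : ℝ) ^ n * coeffNorm (h x.2)) := by ring
      _ ≤ ((1 + x.1 : ℝ) ^ n * coeffNorm (p x.1)) * y x.2 + coeffNorm (m x.1) * y x.2 := by
          have := coeffNorm_nonneg (p x.1)
          have := coeffNorm_nonneg (m x.1)
          gcongr
          · exact hy2 _
          · exact hy1 _
      _ = q x.1 * y x.2 := by rw [hq]; ring
  have hTd : ∀ j : ℕ, (taylor (j : ℂ) P * h j).natDegree ≤ 2 * n := fun j =>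
    natDegree_mul_le.trans (by rw [natDegree_taylor, hPd]; have := hhd j; omega)
  have hkPd : ∀ j : ℕ, (k j * (C α * P)).natDegree ≤ 2 * n := fun j =>
    natDegree_mul_le.trans (by
      have := natDegree_C_mul_le α P
      have := hkd j
      omega)
  have hFd : ∀ j, (F j).natDegree ≤ 2 * n := fun j =>
    (natDegree_sub_le_of_le (hTd j) (hkPd j)).trans (max_self _).le
  obtain ⟨c, J, hc, hcJ⟩ := exists_le_coeffNorm_modByMonic hn lam
  obtain ⟨B, hB0, hB⟩ := exists_coeffNorm_map_le (modByMonicHom P) (2 * n)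
  obtain ⟨D, hD0, hD⟩ := exists_coeffNorm_map_le (divByMonicHom P hPm) (2 * n)
  have hh : ∀ j : ℕ, J ≤ j → (1 + j : ℝ) ^ n * coeffNorm (h j) ≤ B / c * coeffNorm (F j) := by
    intro j hj
    -- Reduction modulo `P` eliminates `k j`, so `h j` is bounded first; `k j` is then recovered by
    -- exact division.
    have h1 : (taylor (j : ℂ) P * h j) %ₘ P = F j %ₘ P := by
      refine modByMonic_eq_of_dvd_sub hPm ⟨k j * C α, ?_⟩
      rw [hF]
      ring
    have h2 := (hcJ j hj (h j) (hhd j)).trans ((congrArg coeffNorm h1).le.trans (hB _ (hFd j)))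
    rw [div_mul_eq_mul_div, le_div_iff₀ hc]
    linarith
  have hk : ∀ j : ℕ, J ≤ j → coeffNorm (k j) ≤
      ‖α‖⁻¹ * (D * (coeffNorm P * (B / c) + 1)) * coeffNorm (F j) := by
    intro j hj
    have h1 : (taylor (j : ℂ) P * h j - F j) /ₘ P = C α * k j := by
      refine (div_modByMonic_unique (C α * k j) 0 hPm ⟨?_, ?_⟩).1
      · rw [hF]
        ring
      · rw [degree_zero]
        exact bot_lt_iff_ne_bot.2 (by simpa using hPm.ne_zero)
    have h2 := hD (taylor (j : ℂ) P * h j - F j)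
      ((natDegree_sub_le_of_le (hTd j) (hFd j)).trans (max_self _).le)
    change coeffNorm ((taylor (j : ℂ) P * h j - F j) /ₘ P) ≤ _ at h2
    rw [h1, coeffNorm_C_mul] at h2
    have h3 : coeffNorm (taylor (j : ℂ) P * h j - F j) ≤
        (coeffNorm P * (B / c) + 1) * coeffNorm (F j) := by
      refine (coeffNorm_sub_le _ _).trans ?_
      rw [add_mul, one_mul]
      refine add_le_add_left ?_ _
      calc _ ≤ coeffNorm (taylor (j : ℂ) P) * coeffNorm (h j) := coeffNorm_mul_le _ _
        _ ≤ ((1 + j : ℝ) ^ n * coeffNorm P) * coeffNorm (h j) :=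
          mul_le_mul_of_nonneg_right (coeffNorm_taylor_le _ _ _ hPd.le) (coeffNorm_nonneg _)
        _ = coeffNorm P * ((1 + j : ℝ) ^ n * coeffNorm (h j)) := by ring
        _ ≤ coeffNorm P * (B / c * coeffNorm (F j)) :=
          mul_le_mul_of_nonneg_left (hh j hj) (coeffNorm_nonneg _)
        _ = _ := by ring
    have hα' : 0 < ‖α‖ := norm_pos_iff.2 hα
    rw [mul_assoc, inv_mul_eq_div, le_div_iff₀ hα', mul_comm _ ‖α‖, mul_assoc]
    exact h2.trans (mul_le_mul_of_nonneg_left h3 hD0)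
  set E := B / c + ‖α‖⁻¹ * (D * (coeffNorm P * (B / c) + 1)) with hE
  have hE0 : 0 ≤ E := by
    have := coeffNorm_nonneg P
    positivity
  have hyg : ∃ C ρ : ℝ, 0 ≤ C ∧ 0 < ρ ∧ ∀ j, y j ≤ C * ρ ^ j := by
    refine exists_geometric_bound_of_convolution (q := fun j => E * q j) hy0 ?_ J fun j hj => ?_
    · obtain ⟨Q, ρ, hQ, hρ, hQq⟩ := hqg
      refine ⟨E * Q, ρ, by positivity, hρ, fun j => ?_⟩
      rw [mul_assoc]
      exact mul_le_mul_of_nonneg_left (hQq j) hE0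
    · calc y j ≤ E * coeffNorm (F j) := by
            rw [hE, add_mul]
            exact add_le_add (hh j hj) (hk j hj)
        _ ≤ E * ∑ p ∈ Finset.HasAntidiagonal.antidiagonal j with p.1 ≠ 0, q p.1 * y p.2 :=
          mul_le_mul_of_nonneg_left (hFq j) hE0
        _ = _ := by
          rw [Finset.mul_sum]
          exact Finset.sum_congr rfl fun x _ => by ring
  obtain ⟨Y, ρ, hY, hρ, hYy⟩ := hyg
  refine ⟨⟨Y, ρ, hY, hρ, fun j => le_trans ?_ ((hy1 j).trans (hYy j))⟩,
    ⟨Y, ρ, hY, hρ, fun j => (hy2 j).trans (hYy j)⟩⟩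
  refine le_mul_of_one_le_left (coeffNorm_nonneg _) (one_le_pow₀ ?_)
  linarith [(Nat.cast_nonneg j : (0 : ℝ) ≤ j)]

/-! ### The normal form -/

/-- Sorting by real part suffices, since adding a positive integer increases it. -/
theorem exists_isNaturalEnumeration (p : ℂ[X]) :
    ∃ lam : Fin p.natDegree → ℂ, IsNaturalEnumeration p lam := by
  have hcard : p.roots.toList.length = p.natDegree := by
    rw [Multiset.length_toList, splits_iff_card_roots.1 (IsAlgClosed.splits p)]
  set f : Fin p.natDegree → ℂ := fun i => p.roots.toList.get (i.cast hcard.symm) with hf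
  have hroots : p.roots = Finset.univ.val.map f := by
    have h1 : List.ofFn f = p.roots.toList := by
      rw [hf, List.ofFn_congr hcard.symm]
      exact List.ofFn_get _
    rw [← Multiset.coe_toList p.roots, ← h1, Fin.univ_val_map]
  refine ⟨f ∘ Tuple.sort fun i => (f i).re, ?_, fun i k j hj h => ?_⟩
  · rw [← Multiset.map_map, hroots]
    congr 1
    exact (congrArg Finset.val (Finset.map_univ_equiv (Tuple.sort fun i => (f i).re))).symm
  · by_contra hki
    have hmono := Tuple.monotone_sort (fun i => (f i).re) (not_lt.1 hki)
    have hre := congrArg Complex.re h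
    simp only [Function.comp_apply, Complex.add_re, Complex.natCast_re] at hmono hre
    have : (0 : ℝ) < j := by exact_mod_cast hj
    linarith

theorem eq_C_mul_rootPoly {n : ℕ} {p : ℂ[X]} {lam : Fin n → ℂ}
    (h : p.roots = Finset.univ.val.map lam) : p = C p.leadingCoeff * rootPoly lam := by
  conv_lhs => rw [(IsAlgClosed.splits p).eq_prod_roots, h]
  rw [Multiset.map_map]
  rfl

theorem resonanceOrders_finite {p : ℂ[X]} (hp : p ≠ 0) (μ : ℂ) : (resonanceOrders p μ).Finite := by
  refine Set.Finite.subset (Set.Finite.preimage (f := fun j : ℕ => μ + (j : ℂ)) ?_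
    (finite_setOfPred_isRoot hp)) fun j hj => hj.2
  intro a _ b _ h
  simpa using h

theorem natDegree_le_of_support_subset {r : ℂ[X]} {J : Set ℕ} (hJ : J.Finite)
    (h : (r.support : Set ℕ) ⊆ J) : r = 0 ∨ ∃ N, IsGreatest J N ∧ r.natDegree ≤ N := by
  by_cases hr : r = 0
  · exact Or.inl hr
  · have hmem : r.natDegree ∈ J := h (natDegree_mem_support_of_nonzero hr)
    obtain ⟨N, hN, hmax⟩ := hJ.exists_maximal ⟨_, hmem⟩
    have hub : ∀ x ∈ J, x ≤ N := fun x hx => (le_total x N).elim id fun h => hmax hx h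
    exact Or.inr ⟨N, ⟨hN, hub⟩, hub _ hmem⟩

theorem exists_reducible_fEquiv (L : FuchsianOperator) {n : ℕ} (hLn : L.order = n)
    (lam : Fin n → ℂ) (hlam : IsNaturalEnumeration L.eulerPart lam) :
    ∃ (r : Fin n → ℂ[X]) (M : FuchsianOperator),
      M.op = reducibleOp lam r ∧ L.FEquiv M ∧
        ∀ i, ((r i).support : Set ℕ) ⊆ resonanceOrders L.eulerPart (lam i) := by
  set p := symbol L.coeffs with hp
  set α := L.eulerPart.leadingCoeff with hα
  have hLp : L.eulerPart = p 0 := L.eulerPart_eq_symbol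
  have hp0 : p 0 = C α * rootPoly lam := hLp ▸ eq_C_mul_rootPoly hlam.1
  have hE0 : L.eulerPart ≠ 0 := fun h => L.leading_ne_zero <| by
    have := congrArg (fun q : ℂ[X] => q.coeff L.coeffs.natDegree) h
    simpa [FuchsianOperator.eulerPart, coeff_map] using this
  have hα0 : α ≠ 0 := leadingCoeff_ne_zero.2 hE0
  rcases eq_or_ne n 0 with rfl | hn
  -- In order zero `M` is the identity; `H = L`, `K = M` work because the Euler part of `L` is a
  -- nonzero constant, coprime to itself.
  · obtain ⟨M, hM, -, hMo⟩ := FuchsianOperator.exists_of_symbol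
      (reducibleSymbol lam fun _ => (0 : ℂ[X]).coeff)
      (by rw [reducibleSymbol_zero]; exact (monic_rootPoly lam).ne_zero)
      (fun j => by
        rw [reducibleSymbol_zero, natDegree_rootPoly]; exact natDegree_reducibleSymbol_le _ _ _)
      (geometricGrowth_of_eventually_zero (A := 0) fun j hj => if_neg hj.ne')
    rw [reducibleSymbol_zero, natDegree_rootPoly] at hMo
    refine ⟨fun _ => 0, M, ?_, ⟨by rw [hLn, hMo], L, M, rfl, ?_⟩, fun i => i.elim0⟩
    · rw [hM]
      exact symbolOp_reducibleSymbol lam (fun _ => 0) fun _ => coeff_zero 0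
    · have : IsUnit L.eulerPart := by
        rw [hLp, hp0, rootPoly, Finset.univ_eq_empty, Finset.prod_empty, mul_one]
        exact isUnit_C.2 hα0.isUnit
      exact isCoprime_self.2 this
  · obtain ⟨c, h, k, hc, hh0, hk0, hhd, hkd, heq⟩ := exists_formal_equivalence hn lam hlam.2 hα0 p
      hp0 fun j => hLn ▸ L.natDegree_symbol_le j
    have hcJ : ∀ i j, c i j ≠ 0 → j ∈ resonanceOrders L.eulerPart (lam i) := by
      intro i j hij
      refine ⟨(hc i j hij).1, ?_⟩
      rw [hLp, hp0, IsRoot, eval_mul, (hc i j hij).2.eq_zero, mul_zero]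
    obtain ⟨B, hB⟩ : ∃ B, ∀ i j, B < j → c i j = 0 := by
      obtain ⟨B, hB⟩ := (Set.finite_iUnion fun i => resonanceOrders_finite hE0 (lam i)).bddAbove
      refine ⟨B, fun i j hj => by_contra fun hij => ?_⟩
      have := hB (Set.mem_iUnion.2 ⟨i, hcJ i j hij⟩)
      omega
    -- Nothing is lost in truncating: all coefficients beyond `B` vanish.
    set r : Fin n → ℂ[X] := fun i => PowerSeries.trunc (B + 1) (PowerSeries.mk (c i)) with hr
    have hrc : (fun i => (r i).coeff) = c := by
      funext i j
      rw [hr, PowerSeries.coeff_trunc, PowerSeries.coeff_mk]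
      split_ifs with hj
      · rfl
      · rw [hB i j (by omega)]
    have hrc' : ∀ i j, (r i).coeff j = c i j := fun i j => congrFun (congrFun hrc i) j
    set m := reducibleSymbol lam c with hm
    have hm0 : m 0 = rootPoly lam := reducibleSymbol_zero lam c
    have hmd : ∀ j, (m j).natDegree ≤ n := natDegree_reducibleSymbol_le lam c
    obtain ⟨A, hA⟩ := exists_forall_reducibleSymbol_eq_zero lam c hB
    have hmg : GeometricGrowth m := geometricGrowth_of_eventually_zero hA
    have hpd : ∀ j, (p j).natDegree ≤ n := fun j => hLn ▸ L.natDegree_symbol_le j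
    have hpg : GeometricGrowth p := L.geometricGrowth_symbol
    obtain ⟨hhg, hkg⟩ := geometricGrowth_of_skewMul_eq hn lam hα0 hm0 hp0 hmd hhd hkd hmg hpg heq
    obtain ⟨M, hM, -, hMo⟩ := FuchsianOperator.exists_of_symbol m
      (by rw [hm0]; exact (monic_rootPoly lam).ne_zero)
      (fun j => by rw [hm0, natDegree_rootPoly]; exact hmd j) hmg
    rw [hm0, natDegree_rootPoly] at hMo
    have hp0n : (p 0).natDegree = n := by rw [← hLp, L.natDegree_eulerPart, hLn]
    have hH0 : (h 0 + p 0).natDegree = n := by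
      rw [natDegree_add_eq_right_of_natDegree_lt (by rw [hp0n]; exact hhd 0), hp0n]
    have hK0 : (k 0 + m 0).natDegree = n := by
      rw [natDegree_add_eq_right_of_natDegree_lt (by rw [hm0, natDegree_rootPoly]; exact hkd 0),
        hm0, natDegree_rootPoly]
    -- Only `h 0 = C α` is known of the leading behaviour of `h`. Adding `p`, of exact degree `n` at
    -- order `0`, makes the operator Fuchsian, and `M (H + L) = (K + M) L` still holds.
    obtain ⟨H, hH, hHe, -⟩ := FuchsianOperator.exists_of_symbol (h + p)
      (fun h0 => hn (by rw [← hH0, ← Pi.add_apply, h0, natDegree_zero]))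
      (fun j => by
        rw [Pi.add_apply h p 0, hH0]
        exact natDegree_add_le_of_degree_le (hhd j).le (hpd j)) (hhg.add hpg)
    obtain ⟨K, hK, -, -⟩ := FuchsianOperator.exists_of_symbol (k + m)
      (fun h0 => hn (by rw [← hK0, ← Pi.add_apply, h0, natDegree_zero]))
      (fun j => by
        rw [Pi.add_apply k m 0, hK0]
        exact natDegree_add_le_of_degree_le (hkd j).le (hmd j)) (hkg.add hmg)
    refine ⟨r, M, ?_, ⟨by rw [hLn, hMo], H, K, ?_, ?_⟩, fun i j hj => ?_⟩
    · rw [hM, hm, ← hrc]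
      refine symbolOp_reducibleSymbol lam r fun i => ?_
      rw [hrc']
      exact by_contra fun h0 => (hc i 0 h0).1.false
    · have hop : symbolOp m * symbolOp h = symbolOp k * symbolOp p := by
        rw [← symbolOp_skewMul, ← symbolOp_skewMul, funext heq]
      rw [hM, hH, hK, L.op_eq_symbolOp, ← hp, symbolOp_add, symbolOp_add, mul_add, add_mul, hop]
    · rw [hHe, hLp, Pi.add_apply, hh0]
      have hα1 : C α⁻¹ * C α = (1 : ℂ[X]) := by rw [← C_mul, inv_mul_cancel₀ hα0, C_1]
      exact ⟨C α⁻¹, -C α⁻¹, by linear_combination hα1⟩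
    · rw [Finset.mem_coe, mem_support_iff, hrc'] at hj
      exact hcJ i j hj

end

theorem theorem7 (L : FuchsianOperator) :
    (∃ lam : Fin L.order → ℂ, IsNaturalEnumeration L.eulerPart lam) ∧
    ∀ lam : Fin L.order → ℂ, IsNaturalEnumeration L.eulerPart lam →
      ∃ (r : Fin L.order → ℂ[X]) (M : FuchsianOperator),
        M.op = reducibleOp lam r ∧ L.FEquiv M ∧
        ∀ i : Fin L.order,
          ((r i).support : Set ℕ) ⊆ resonanceOrders L.eulerPart (lam i) ∧
          (r i = 0 ∨ ∃ N : ℕ, IsGreatest (resonanceOrders L.eulerPart (lam i)) N ∧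
            (r i).natDegree ≤ N) := by
  refine ⟨L.natDegree_eulerPart ▸ exists_isNaturalEnumeration L.eulerPart, fun lam hlam => ?_⟩
  obtain ⟨r, M, hM, hLM, hr⟩ := exists_reducible_fEquiv L rfl lam hlam
  refine ⟨r, M, hM, hLM, fun i => ⟨hr i, ?_⟩⟩
  refine natDegree_le_of_support_subset (resonanceOrders_finite (fun h0 => ?_) _) (hr i)
  have hi := L.natDegree_eulerPart
  rw [h0, natDegree_zero] at hi
  -- A zero Euler part would force order zero, leaving no index `i`.
  exact (hi ▸ i).elim0
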